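/- Theorem 2 (MIS, slow in $\Delta$). For every constant $c\ge 1$ there are a deterministic algorithm $\mathcal{A}$ in the LOCAL model and a constant $C$, depending only on $c$, such that the following holds. Let $H=(V,E)$ be a finite hypergraph with $n$ nodes whose hyperedges are non-empty subsets of $V$, let $\Delta$ be its maximum degree (the maximum over all nodes of the number of incident hyperedges), let $r=\max_{e\in E}|e|$ be its rank (with $\Delta=r=0$ if $E=\emptyset$), and let the nodes have unique identifiers from $\{1,\ldots,n^c\}$. Then $\mathcal{A}$, run on $H$, computes a maximal independent set of $H$ within $$C\cdot\bigl(\Delta^2\log r+\Delta\log r\,\log^* r+\log^* n\bigr)$$ rounds. Here an independent set is a set $S\subseteq V$ that contains no hyperedge as a subset, and it is maximal if it is inclusion-wise maximal among the independent sets. Logarithms are to base $2$, $\log r$ is read as $0$ if $r=0$, and $\log^* x$ is the least number of times that the logarithm has to be applied, starting from $x$, until the result is at most $1$. In the LOCAL model all nodes run the same algorithm. Each node initially knows its own identifier, its own degree, $\Delta$, $r$ and $n$; the computation proceeds in synchronous rounds, in each of which every node exchanges messages of unbounded size with the other nodes of its incident hyperedges and performs an unbounded local computation. An MIS is computed within $T$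 rounds if after $T$ rounds every node has terminated and has decided whether it is in the set, and the nodes that decided to be in the set form an MIS. -/

import Mathlib

noncomputable section

/-- The iterated logarithm `log* x`: the least number of times that the base-2 logarithm has to be
applied, starting from `x`, until the result is at most `1`. -/
def logStar (x : ℝ) : ℕ := sInf {k : ℕ | (Real.logb 2)^[k] x ≤ 1}

namespace Hypergraph

/-- The degree of a node: the number of its incident hyperedges. -/
def degree {α : Type*} (H : Hypergraph α) (v : α) : ℕ := {e ∈ H.edgeSet | v ∈ e}.ncard

/-- The maximum degree `Δ` of a (finite) hypergraph; it is `0` if there are no nodes. -/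
def maxDegree {α : Type*} (H : Hypergraph α) : ℕ := sSup (H.degree '' H.vertexSet)

/-- The rank `r` of a (finite) hypergraph, that is, its maximum hyperedge cardinality; it is `0` if
there are no hyperedges. -/
def rank {α : Type*} (H : Hypergraph α) : ℕ := sSup (Set.ncard '' H.edgeSet)

/-- An independent set: a set of nodes that does not fully contain any hyperedge. -/
def IsIndependent {α : Type*} (H : Hypergraph α) (S : Set α) : Prop :=
  S ⊆ H.vertexSet ∧ ∀ e ∈ H.edgeSet, e ∩ S ≠ e

/-- A maximal independent set (MIS): an inclusion-wise maximal independent set. -/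
def IsMIS {α : Type*} (H : Hypergraph α) (S : Set α) : Prop := Maximal H.IsIndependent S

/-- An assignment of unique identifiers from `{1, …, n ^ c}` to the nodes of an `n`-node
hypergraph. -/
def IsIdentifier {α : Type*} (H : Hypergraph α) (c : ℕ) (ident : α → ℕ) : Prop :=
  Set.InjOn ident H.vertexSet ∧
    ∀ v ∈ H.vertexSet, 1 ≤ ident v ∧ ident v ≤ H.vertexSet.ncard ^ c

end Hypergraph

/-- A deterministic algorithm in the LOCAL model on hypergraphs. All nodes run the same algorithm.
There is no bound on the local computation (the fields are arbitrary functions) or on the size of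
the messages. In each round a node sends one message to all its neighbours; as messages are
unbounded and nodes have unique identifiers, content meant for particular neighbours only can be
addressed inside that message. -/
structure LocalAlgorithm (Out : Type) where
  /-- local states of a node -/
  State : Type
  /-- messages -/
  Msg : Type
  /-- The initial state of a node, which initially knows (in this order) the number `n` of nodes,
  the maximum degree `Δ`, the rank `r`, its own identifier and its own degree. -/
  init : ℕ → ℕ → ℕ → ℕ → ℕ → State
  /-- the message that a node in the given state sends to its neighbours -/
  send : State → Msg
  /-- The new state of a node, from its old state and what it receives: for each incident
  hyperedge, the messages of the other nodes of this hyperedge, each with its sender's identifier.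
  -/
  receive : State → Set (Set (ℕ × Msg)) → State
  /-- `some o` if a node in this state has terminated with the local output `o`, and `none` if it
  is still running -/
  output : State → Option Out

namespace LocalAlgorithm

/-- What the node `v` receives in one round if the nodes are in the states `σ`. Every hyperedge that
is incident to `v` contributes the set of the messages of its other nodes; identifiers
being unique, this loses no multiplicities. -/
def inbox {Out : Type} (A : LocalAlgorithm Out) {α : Type*} (H : Hypergraph α) (ident : α → ℕ)
    (σ : α → A.State) (v : α) : Set (Set (ℕ × A.Msg)) :=
  {B | ∃ e ∈ H.edgeSet, v ∈ e ∧ B = (fun u => (ident u, A.send (σ u))) '' (e \ {v})}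

/-- The state of each node after `t` synchronous communication rounds. A node that has terminated
never changes its state, hence its output, any more. -/
def stateAfter {Out : Type} (A : LocalAlgorithm Out) {α : Type*} (H : Hypergraph α)
    (ident : α → ℕ) : ℕ → α → A.State
  | 0 => fun v => A.init H.vertexSet.ncard H.maxDegree H.rank (ident v) (H.degree v)
  | t + 1 => fun v =>
      match A.output (A.stateAfter H ident t v) with
      | some _ => A.stateAfter H ident t v
      | none => A.receive (A.stateAfter H ident t v)
          (A.inbox H ident (A.stateAfter H ident t) v)

/-- Run on `H` with the identifiers `ident`, every node decides its local output and terminates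
within `T` communication rounds, and node `v` outputs `out v`. -/
def ComputesWithin {Out : Type} (A : LocalAlgorithm Out) {α : Type*} (H : Hypergraph α)
    (ident : α → ℕ) (T : ℕ) (out : α → Out) : Prop :=
  ∀ v ∈ H.vertexSet, A.output (A.stateAfter H ident T v) = some (out v)

/-- Run on `H` with the identifiers `ident`, the algorithm computes an MIS within `T` communication
rounds: every node decides by then whether it is in the set, and the nodes that decide to be in
the set form an MIS. -/
def SolvesMISWithin (A : LocalAlgorithm Bool) {α : Type*} (H : Hypergraph α)
    (ident : α → ℕ) (T : ℕ) : Prop :=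
  ∃ out : α → Bool, A.ComputesWithin H ident T out ∧
    H.IsMIS {v | v ∈ H.vertexSet ∧ out v = true}

end LocalAlgorithm

end

/-! A node may gather hyperedges for a while and then decide alone, so it suffices to find a
membership predicate that is `IsLocal` with a small enough radius (`IsLocal.known_eq`,
`gossip_computesWithin`).

An independent set grows in phases. A node is blocked if adding it would complete a hyperedge. A
hyperedge with a blocked node is never filled, so only alive hyperedges matter. In each of them the
free nodes are paired up. A node has at most one mate per incident hyperedge, so the graph of mates
has degree at most Δ instead of Δr, and a colour class of it takes at most about half of the free
nodes of an alive hyperedge. The colours are processed in turn, and a node joins unless one of its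
alive hyperedges already has a quarter of its free nodes selected. Then no hyperedge is filled
(`card_selected_lt`), while a node that stays undecided has an alive hyperedge that lost a quarter
of its free nodes (`exists_saturated`). Summing the logarithms of the cubed free counts gives an
integer potential, at most Δ log r³, that drops in each phase (`potential_or_selected_lt`). Hence
O(Δ log r) phases suffice.

A phase costs O(Δ + log* r) rounds for constant `c`. Linial's reduction (`exists_linial_iterate`) is
applied once to the identifiers on the primal graph, and leaves poly(Δr) colours after log* n
rounds. Each phase restarts from this colouring, reduces it to poly(Δ) colours in log* r rounds, and
then to O(Δ) colours in O(Δ) rounds by additive-group colouring (`exists_linear_coloring`). -/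

namespace HypergraphMIS

/-! ### Local labellings -/

/-- The hyperedges that a node knows after `t` rounds in which all nodes forward all they know. -/
def known : ℕ → Finset (Finset ℕ) → ℕ → Finset (Finset ℕ)
  | 0, _, _ => ∅
  | t + 1, E, v => known t E v ∪
      {e ∈ E | v ∈ e}.biUnion fun e => insert e (e.biUnion (known t E))

theorem known_mono {s t : ℕ} (h : s ≤ t) (E : Finset (Finset ℕ)) (v : ℕ) :
    known s E v ⊆ known t E v := by
  induction h with
  | refl => exact Finset.Subset.refl _
  | step _ ih => exact ih.trans Finset.subset_union_left

theorem known_subset (t : ℕ) (E : Finset (Finset ℕ)) (v : ℕ) : known t E v ⊆ E := by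
  induction t generalizing v with
  | zero => simp [known]
  | succ t ih =>
    intro f hf
    simp only [known, Finset.mem_union, Finset.mem_biUnion, Finset.mem_filter,
      Finset.mem_insert] at hf
    rcases hf with hf | ⟨e, ⟨he, -⟩, rfl | ⟨u, -, hf⟩⟩
    · exact ih v hf
    · exact he
    · exact ih u hf

/-- The labelling `g` of the nodes of all hypergraphs can be computed in `t` rounds: the label of
`v` is determined by the hyperedges that `v` knows after `t` rounds. -/
def IsLocal {X : Type*} (t : ℕ) (g : Finset (Finset ℕ) → ℕ → X) : Prop :=
  ∀ E E' v, known t E v ⊆ E' → E' ⊆ E → g E v = g E' v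

namespace IsLocal

variable {X Y Z : Type*} {s t : ℕ} {g : Finset (Finset ℕ) → ℕ → X}

theorem mono (hg : IsLocal s g) (h : s ≤ t) : IsLocal t g :=
  fun E E' v h1 h2 => hg E E' v ((known_mono h E v).trans h1) h2

/-- The known hyperedges themselves are an admissible subhypergraph, so a node can evaluate `g` on
its own knowledge. -/
theorem known_eq (hg : IsLocal t g) (E : Finset (Finset ℕ)) (v : ℕ) :
    g (known t E v) v = g E v :=
  (hg E _ v (Finset.Subset.refl _) (known_subset t E v)).symm

theorem map (hg : IsLocal t g) (f : X → Y) : IsLocal t fun E v => f (g E v) :=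
  fun E E' v h1 h2 => congrArg f (hg E E' v h1 h2)

theorem map₂ {h : Finset (Finset ℕ) → ℕ → Y} (hg : IsLocal t g) (hh : IsLocal t h)
    (f : X → Y → Z) : IsLocal t fun E v => f (g E v) (h E v) :=
  fun E E' v h1 h2 => congrArg₂ f (hg E E' v h1 h2) (hh E E' v h1 h2)

theorem of_id (t : ℕ) (f : ℕ → X) : IsLocal t fun _ v => f v := fun _ _ _ _ _ => rfl

/-- A labelling that depends only on the incident hyperedges and the labels on them. -/
theorem step {h : Finset (Finset ℕ) → ℕ → Y} (hg : IsLocal t g)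
    (hh : ∀ E E' v, (∀ e, v ∈ e → (e ∈ E ↔ e ∈ E')) → g E v = g E' v →
      (∀ e ∈ E, v ∈ e → ∀ u ∈ e, g E u = g E' u) → h E v = h E' v) :
    IsLocal (t + 1) h := by
  intro E E' v h1 h2
  have hk : ∀ e ∈ E, v ∈ e → insert e (e.biUnion (known t E)) ⊆ E' := fun e he hv f hf =>
    h1 (Finset.mem_union_right _
      (Finset.mem_biUnion.2 ⟨e, Finset.mem_filter.2 ⟨he, hv⟩, hf⟩))
  refine hh E E' v (fun e hv => ⟨fun he => hk e he hv (Finset.mem_insert_self _ _),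
    fun he => h2 he⟩) (hg E E' v (Finset.subset_union_left.trans h1) h2) ?_
  intro e he hv u hu
  refine hg E E' u (fun f hf => hk e he hv (Finset.mem_insert_of_mem ?_)) h2
  exact Finset.mem_biUnion.2 ⟨u, hu, hf⟩

end IsLocal

/-! ### The gossip algorithm -/

/-- The elements of a finite set as a `Finset` (empty for infinite sets). -/
noncomputable def finsetOf {X : Type} (s : Set X) : Finset X :=
  open Classical in if h : s.Finite then h.toFinset else ∅

theorem mem_finsetOf {X : Type} {s : Set X} (h : s.Finite) {x : X} : x ∈ finsetOf s ↔ x ∈ s := by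
  simp [finsetOf, h]

theorem finsetOf_eq {X : Type} {s : Set X} {t : Finset X} (h : s = ↑t) : finsetOf s = t := by
  ext x
  rw [mem_finsetOf (h ▸ t.finite_toSet), h, Finset.mem_coe]

/-- The state of a node in a gossip algorithm. -/
structure GossipState where
  /-- number of nodes -/
  n : ℕ
  /-- maximum degree -/
  maxDeg : ℕ
  /-- rank -/
  rank : ℕ
  /-- own identifier -/
  ident : ℕ
  /-- own degree -/
  deg : ℕ
  /-- number of elapsed rounds -/
  time : ℕ
  /-- known hyperedges, as sets of identifiers -/
  edges : Finset (Finset ℕ)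

/-- The hyperedges that a node with identifier `id`, knowing `K`, knows after receiving `I`. -/
noncomputable def gossipUpdate (id : ℕ) (K : Finset (Finset ℕ))
    (I : Set (Set (ℕ × Finset (Finset ℕ)))) : Finset (Finset ℕ) :=
  -- An inbox entry omits the receiver: its identifier is put back into each hyperedge here, and the
  -- disjunct with `K` below supplies its own knowledge.
  K ∪ (finsetOf ((fun B => insert id (finsetOf (Prod.fst '' B))) '' I) ∪
    finsetOf {f | f ∈ K ∧ I.Nonempty ∨ ∃ B ∈ I, ∃ p ∈ B, f ∈ p.2})

/-- The algorithm in which every node collects all hyperedges known in its neighbourhood, and after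
`T n Δ r` rounds outputs a function of what it knows. -/
noncomputable def gossip (T : ℕ → ℕ → ℕ → ℕ)
    (F : ℕ → ℕ → ℕ → ℕ → ℕ → Finset (Finset ℕ) → Bool) : LocalAlgorithm Bool where
  State := GossipState
  Msg := Finset (Finset ℕ)
  init n Δ r id d := ⟨n, Δ, r, id, d, 0, ∅⟩
  send s := s.edges
  receive s I := { s with
    time := s.time + 1
    edges := gossipUpdate s.ident s.edges I }
  output s := if T s.n s.maxDeg s.rank ≤ s.time then
    some (F s.n s.maxDeg s.rank s.deg s.ident s.edges) else none

section gossip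

variable {α : Type*} {H : Hypergraph α} {ident : α → ℕ} {E : Finset (Finset ℕ)}
  {T : ℕ → ℕ → ℕ → ℕ} {F : ℕ → ℕ → ℕ → ℕ → ℕ → Finset (Finset ℕ) → Bool}

theorem gossipUpdate_eq (hfin : H.vertexSet.Finite) (hinj : Set.InjOn ident H.vertexSet)
    (hE : ∀ f : Finset ℕ, f ∈ E ↔ ∃ e ∈ H.edgeSet, (f : Set ℕ) = ident '' e)
    (κ : α → Finset (Finset ℕ)) (t : ℕ)
    (hκ : ∀ v ∈ H.vertexSet, κ v = known t E (ident v)) {v : α} (hv : v ∈ H.vertexSet) :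
    gossipUpdate (ident v) (κ v)
      {B | ∃ e ∈ H.edgeSet, v ∈ e ∧ B = (fun u => (ident u, κ u)) '' (e \ {v})} =
      known (t + 1) E (ident v) := by
  have hsub : ∀ e ∈ H.edgeSet, e ⊆ H.vertexSet := fun e he => H.subset_vertexSet_of_mem_edgeSet' he
  have hmem : ∀ e ∈ H.edgeSet, ident v ∈ ident '' e ↔ v ∈ e := fun e he =>
    hinj.mem_image_iff (hsub e he) hv
  have hvE : ∀ f : Finset ℕ, (f ∈ E ∧ ident v ∈ f) ↔
      ∃ e ∈ H.edgeSet, v ∈ e ∧ (f : Set ℕ) = ident '' e := by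
    intro f
    rw [hE]
    constructor
    · rintro ⟨⟨e, he, hf⟩, h⟩
      rw [← Finset.mem_coe, hf, hmem e he] at h
      exact ⟨e, he, h, hf⟩
    · rintro ⟨e, he, h, hf⟩
      refine ⟨⟨e, he, hf⟩, ?_⟩
      rw [← Finset.mem_coe, hf, hmem e he]
      exact h
  set I : Set (Set (ℕ × Finset (Finset ℕ))) :=
    {B | ∃ e ∈ H.edgeSet, v ∈ e ∧ B = (fun u => (ident u, κ u)) '' (e \ {v})} with hI
  have h1 : finsetOf ((fun B => insert (ident v) (finsetOf (Prod.fst '' B))) '' I) =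
      {f ∈ E | ident v ∈ f} := by
    apply finsetOf_eq
    ext f
    simp only [Set.mem_image, Finset.coe_filter, Set.mem_ofPred_eq, hvE]
    have key : ∀ e ∈ H.edgeSet, v ∈ e → ∀ B : Set (ℕ × Finset (Finset ℕ)),
        B = (fun u => (ident u, κ u)) '' (e \ {v}) →
        ((insert (ident v) (finsetOf (Prod.fst '' B)) : Finset ℕ) : Set ℕ) = ident '' e := by
      rintro e he hve B rfl
      have hf : (Prod.fst '' ((fun u => (ident u, κ u)) '' (e \ {v}))) =
          ident '' (e \ {v}) := by
        rw [Set.image_image]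
      have hfi : (ident '' (e \ {v})).Finite := ((hfin.subset (hsub e he)).sdiff).image _
      rw [hf]
      ext x
      rw [Finset.coe_insert, Set.mem_insert_iff, Finset.mem_coe, mem_finsetOf hfi]
      constructor
      · rintro (rfl | ⟨u, hu, rfl⟩)
        · exact ⟨v, hve, rfl⟩
        · exact ⟨u, hu.1, rfl⟩
      · rintro ⟨u, hu, rfl⟩
        by_cases huv : u = v
        · exact Or.inl (by rw [huv])
        · exact Or.inr ⟨u, ⟨hu, huv⟩, rfl⟩
    constructor
    · rintro ⟨B, ⟨e, he, hve, hB⟩, rfl⟩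
      exact ⟨e, he, hve, key e he hve B hB⟩
    · rintro ⟨e, he, hve, hf⟩
      refine ⟨_, ⟨e, he, hve, rfl⟩, ?_⟩
      rw [← Finset.coe_inj, hf]
      exact key e he hve _ rfl
  have h2 : finsetOf {f | f ∈ κ v ∧ I.Nonempty ∨ ∃ B ∈ I, ∃ p ∈ B, f ∈ p.2} =
      {f ∈ E | ident v ∈ f}.biUnion fun f => f.biUnion (known t E) := by
    apply finsetOf_eq
    ext f
    simp only [Set.mem_ofPred_eq, Finset.coe_biUnion, Set.mem_iUnion, Finset.mem_coe,
      Finset.mem_filter]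
    constructor
    · rintro (⟨hf, ⟨B, e, he, hve, -⟩⟩ | ⟨B, ⟨e, he, hve, rfl⟩, p, ⟨u, hu, rfl⟩, hf⟩)
      · refine ⟨((hfin.subset (hsub e he)).image ident).toFinset, (hvE _).2 ⟨e, he, hve, by simp⟩,
          ident v, by simpa using ⟨v, hve, rfl⟩, ?_⟩
        rwa [← hκ v hv]
      · refine ⟨((hfin.subset (hsub e he)).image ident).toFinset, (hvE _).2 ⟨e, he, hve, by simp⟩,
          ident u, by simpa using ⟨u, hu.1, rfl⟩, ?_⟩
        rwa [← hκ u (hsub e he hu.1)]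
    · rintro ⟨g, hg, x, hx, hf⟩
      obtain ⟨e, he, hve, hge⟩ := (hvE g).1 hg
      rw [← Finset.mem_coe, hge] at hx
      obtain ⟨u, hu, rfl⟩ := hx
      rw [← hκ u (hsub e he hu)] at hf
      by_cases huv : u = v
      · subst huv
        exact Or.inl ⟨hf, ⟨_, e, he, hve, rfl⟩⟩
      · exact Or.inr ⟨_, ⟨e, he, hve, rfl⟩, _, ⟨u, ⟨hu, huv⟩, rfl⟩, hf⟩
  rw [gossipUpdate, h1, h2, hκ v hv, known]
  congr 1
  ext f
  simp only [Finset.mem_union, Finset.mem_biUnion, Finset.mem_insert]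
  constructor
  · rintro (h | ⟨e, he, h⟩)
    · exact ⟨f, h, Or.inl rfl⟩
    · exact ⟨e, he, Or.inr h⟩
  · rintro ⟨e, he, rfl | h⟩
    · exact Or.inl he
    · exact Or.inr ⟨e, he, h⟩

theorem stateAfter_succ {Out : Type} {A : LocalAlgorithm Out} {t : ℕ} {v : α}
    (h : A.output (A.stateAfter H ident t v) = none) :
    A.stateAfter H ident (t + 1) v = A.receive (A.stateAfter H ident t v)
      (A.inbox H ident (A.stateAfter H ident t) v) := by
  simp only [LocalAlgorithm.stateAfter, h]

theorem gossip_stateAfter (hfin : H.vertexSet.Finite) (hinj : Set.InjOn ident H.vertexSet)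
    (hE : ∀ f : Finset ℕ, f ∈ E ↔ ∃ e ∈ H.edgeSet, (f : Set ℕ) = ident '' e)
    {t : ℕ} (ht : t ≤ T H.vertexSet.ncard H.maxDegree H.rank) {v : α} (hv : v ∈ H.vertexSet) :
    (gossip T F).stateAfter H ident t v = (⟨H.vertexSet.ncard, H.maxDegree, H.rank, ident v,
      H.degree v, t, known t E (ident v)⟩ : GossipState) := by
  induction t generalizing v with
  | zero => rfl
  | succ t ih =>
    have ih' := fun {v} hv => @ih (by omega) v hv
    have hout : (gossip T F).output ((gossip T F).stateAfter H ident t v) = none := by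
      rw [ih' hv]
      simp only [gossip]
      rw [if_neg (by omega)]
    have hed := gossipUpdate_eq hfin hinj hE
      (fun u => ((gossip T F).stateAfter H ident t u : GossipState).edges) t
      (fun u hu => by rw [ih' hu]) hv
    rw [stateAfter_succ hout, ← hed]
    change GossipState.mk _ _ _ _ _ _ (gossipUpdate _ _ _) = _
    rw [ih' hv]
    rfl

theorem gossip_computesWithin (hfin : H.vertexSet.Finite) (hinj : Set.InjOn ident H.vertexSet)
    (hE : ∀ f : Finset ℕ, f ∈ E ↔ ∃ e ∈ H.edgeSet, (f : Set ℕ) = ident '' e)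
    {n Δ r : ℕ} (hn : H.vertexSet.ncard = n) (hΔ : H.maxDegree = Δ) (hr : H.rank = r) :
    (gossip T F).ComputesWithin H ident (T n Δ r) fun v =>
      F n Δ r (H.degree v) (ident v) (known (T n Δ r) E (ident v)) := by
  subst hn hΔ hr
  intro v hv
  rw [gossip_stateAfter hfin hinj hE le_rfl hv]
  simp [gossip]

end gossip

/-! ### Linial's colour reduction -/

/-- `N v` is the set of neighbours of `v` in a loopless graph with maximum degree at most `D`. -/
structure IsGraph (D : ℕ) (N : ℕ → Finset ℕ) : Prop where
  symm : ∀ ⦃u v⦄, u ∈ N v → v ∈ N u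
  irrefl : ∀ v, v ∉ N v
  card_le : ∀ v, (N v).card ≤ D

/-- Neighbours have different colours. -/
def IsProper {X : Type*} (N : ℕ → Finset ℕ) (col : ℕ → X) : Prop :=
  ∀ v, ∀ u ∈ N v, col u ≠ col v

/-- The neighbourhoods lie within hyperedges. -/
def IsOneHop (N : Finset (Finset ℕ) → ℕ → Finset ℕ) : Prop :=
  ∀ E v, ∀ u ∈ N E v, ∃ e ∈ E, v ∈ e ∧ u ∈ e

theorem IsLocal.colorStep {X Y : Type*} [DecidableEq X] {s : ℕ}
    {N : Finset (Finset ℕ) → ℕ → Finset ℕ} {col : Finset (Finset ℕ) → ℕ → X}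
    (hcol : IsLocal s col) (hN : IsOneHop N) (hNs : IsLocal s N) (Ψ : X → Finset X → Y) :
    IsLocal (s + 1) fun E v => Ψ (col E v) ((N E v).image (col E)) := by
  refine IsLocal.step (hNs.map₂ hcol Prod.mk) ?_
  intro E E' v _ hv he
  simp only [Prod.mk.injEq] at hv he
  rw [hv.2, ← hv.1]
  congr 1
  refine Finset.image_congr fun u hu => ?_
  obtain ⟨e, heE, hve, hue⟩ := hN E v u hu
  exact (he e heE hve u hue).2

section Linial

-- There are exactly `p ^ d` polynomials of degree below `d`, so colours can be coded by
-- polynomials.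
open Polynomial in
theorem exists_polynomial_family (p d : ℕ) [Fact p.Prime] :
    ∃ P : ℕ → (ZMod p)[X], (∀ c, (P c).degree < d) ∧
      ∀ c c', c < p ^ d → c' < p ^ d → P c = P c' → c = c' := by
  have hcard : Fintype.card (Fin d → ZMod p) = Fintype.card (Fin (p ^ d)) := by
    simp [ZMod.card]
  let e : Fin (p ^ d) ≃ (Fin d → ZMod p) := (Fintype.equivOfCardEq hcard).symm
  let P : ℕ → degreeLT (ZMod p) d := fun c =>
    if h : c < p ^ d then (degreeLTEquiv (ZMod p) d).symm (e ⟨c, h⟩) else 0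
  refine ⟨fun c => (P c : (ZMod p)[X]), fun c => mem_degreeLT.1 (P c).2, ?_⟩
  intro c c' hc hc' h
  have h' : P c = P c' := Subtype.ext h
  simp only [P, hc, hc', dif_pos] at h'
  simpa using e.injective ((degreeLTEquiv (ZMod p) d).symm.injective h')

/-- One round of Linial's colour reduction. -/
theorem exists_colorReduction (p d D : ℕ) [Fact p.Prime] (hp : D * d < p) :
    ∃ Ψ : ℕ → Finset ℕ → ZMod p × ZMod p, ∀ (N : ℕ → Finset ℕ) (col : ℕ → ℕ), IsGraph D N →
      IsProper N col → (∀ v, col v < p ^ d) →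
      IsProper N fun v => Ψ (col v) ((N v).image col) := by
  classical
  obtain ⟨P, hdeg, hinj⟩ := exists_polynomial_family p d
  -- Distinct polynomials of degree below `d` agree in at most `d` points, so at most `D * d < p`
  -- points are bad. The assumptions stand under the existential so that `x` becomes a total
  -- function of what a node sees.
  have key : ∀ (c : ℕ) (A : Finset ℕ), ∃ x : ZMod p, A.card ≤ D → c < p ^ d →
      (∀ a ∈ A, a < p ^ d ∧ a ≠ c) → ∀ a ∈ A, (P a).eval x ≠ (P c).eval x := by
    intro c A
    by_contra! hcon
    obtain ⟨hA, hc, hAc, -⟩ := hcon 0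
    have hcover : (Finset.univ : Finset (ZMod p)) ⊆
        A.biUnion fun a => (P a - P c).roots.toFinset := by
      intro x _
      obtain ⟨-, -, -, a, ha, hax⟩ := hcon x
      rw [Finset.mem_biUnion]
      refine ⟨a, ha, ?_⟩
      have hne : P a - P c ≠ 0 := fun h =>
        (hAc a ha).2 (hinj a c (hAc a ha).1 hc (sub_eq_zero.1 h))
      rw [Multiset.mem_toFinset, Polynomial.mem_roots hne]
      simp [hax]
    have h1 := Finset.card_le_card hcover
    have h2 : (A.biUnion fun a => (P a - P c).roots.toFinset).card ≤ A.card * d := by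
      refine Finset.card_biUnion_le_card_mul _ _ _ fun a ha => ?_
      refine (Multiset.toFinset_card_le _).trans ((Polynomial.card_roots' _).trans ?_)
      refine Polynomial.natDegree_le_of_degree_le ?_
      exact (Polynomial.degree_sub_le _ _).trans (max_le (hdeg a).le (hdeg c).le)
    rw [Finset.card_univ, ZMod.card] at h1
    exact absurd (h1.trans (h2.trans (Nat.mul_le_mul_right d hA))) (by omega)
  choose x hx using key
  refine ⟨fun c A => (x c A, (P c).eval (x c A)), fun N col hN hcol hlt v u hu heq => ?_⟩
  simp only [Prod.mk.injEq] at heq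
  refine hx (col v) ((N v).image col) (Finset.card_image_le.trans (hN.card_le v)) (hlt v) ?_
    (col u) (Finset.mem_image_of_mem _ hu) ?_
  · intro a ha
    obtain ⟨w, hw, rfl⟩ := Finset.mem_image.1 ha
    exact ⟨hlt w, hcol v w hw⟩
  · rw [← heq.2, heq.1]

theorem clog_mul_le (x y : ℕ) : Nat.clog 2 (x * y) ≤ Nat.clog 2 x + Nat.clog 2 y := by
  rw [Nat.clog_le_iff_le_pow one_lt_two, pow_add]
  exact Nat.mul_le_mul (Nat.le_pow_clog one_lt_two x) (Nat.le_pow_clog one_lt_two y)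

theorem clog_add_le (b l : ℕ) : Nat.clog 2 (b + l + 1) ≤ Nat.clog 2 b + l + 1 := by
  rw [Nat.clog_le_iff_le_pow one_lt_two, pow_add, pow_add]
  have h1 : b ≤ 2 ^ Nat.clog 2 b := Nat.le_pow_clog one_lt_two b
  have h2 : l + 1 ≤ 2 ^ l := Nat.lt_two_pow_self
  have h3 : 1 ≤ 2 ^ Nat.clog 2 b := Nat.one_le_two_pow
  nlinarith [Nat.mul_le_mul h3 h2]

/-- The logarithm of `p` is about log D + j + log b, so passing to `p * p` colours replaces `b` by
its logarithm. The bound on `j` gives `4 + 2 * j ≤ 2 ^ j`, which absorbs the remaining terms. -/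
theorem linial_bound {j D b p : ℕ} (hj : 4 ≤ j)
    (hp : p ≤ 2 * (D * (2 ^ j * (b + Nat.clog 2 D + 1)))) :
    p * p ≤ 2 ^ (2 ^ j * (Nat.clog 2 b + Nat.clog 2 D + 1)) := by
  set l := Nat.clog 2 D
  have h1 : Nat.clog 2 p ≤ 2 + 2 * l + j + Nat.clog 2 b := by
    refine (Nat.clog_mono_right 2 hp).trans ?_
    have e1 := clog_mul_le 2 (D * (2 ^ j * (b + l + 1)))
    have e2 := clog_mul_le D (2 ^ j * (b + l + 1))
    have e3 := clog_mul_le (2 ^ j) (b + l + 1)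
    have e4 := clog_add_le b l
    have e5 : Nat.clog 2 2 = 1 := by
      simpa using Nat.clog_pow 2 1 one_lt_two
    have e6 : Nat.clog 2 (2 ^ j) = j := Nat.clog_pow 2 j one_lt_two
    change _ ≤ Nat.clog 2 D + _ at e2
    omega
  have h2 : 4 + 2 * j ≤ 2 ^ j := by
    clear h1 hp
    induction j, hj using Nat.le_induction with
    | base => norm_num
    | succ j _ ih => rw [pow_succ]; omega
  have h3 : p ≤ 2 ^ Nat.clog 2 p := Nat.le_pow_clog one_lt_two p
  calc p * p ≤ 2 ^ Nat.clog 2 p * 2 ^ Nat.clog 2 p := Nat.mul_le_mul h3 h3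
    _ = 2 ^ (Nat.clog 2 p + Nat.clog 2 p) := (pow_add _ _ _).symm
    _ ≤ _ := by
      refine Nat.pow_le_pow_right two_pos ?_
      nlinarith [Nat.mul_le_mul_right (Nat.clog 2 b + l + 1) h2]

end Linial

/-- Iterating Linial's colour reduction. -/
theorem exists_linial_iterate {s D j b₀ : ℕ} (hD : 1 ≤ D) (hj : 4 ≤ j)
    {N : Finset (Finset ℕ) → ℕ → Finset ℕ} (hN : IsOneHop N) (hNs : IsLocal s N)
    {col : Finset (Finset ℕ) → ℕ → ℕ} (hcol : IsLocal s col) (k : ℕ) :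
    ∃ col' : Finset (Finset ℕ) → ℕ → ℕ, IsLocal (s + k) col' ∧
      ∀ E, IsGraph D (N E) → IsProper (N E) (col E) →
        (∀ v, col E v < 2 ^ (2 ^ j * (b₀ + Nat.clog 2 D + 1))) →
        IsProper (N E) (col' E) ∧
        ∀ v, col' E v < 2 ^ (2 ^ j * ((Nat.clog 2)^[k] b₀ + Nat.clog 2 D + 1)) := by
  induction k with
  | zero => exact ⟨col, hcol, fun E _ h1 h2 => ⟨h1, h2⟩⟩
  | succ k ih =>
    obtain ⟨col', hloc, hcol'⟩ := ih
    set b := (Nat.clog 2)^[k] b₀ with hb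
    -- With `L` coefficients, `p ^ L ≥ 2 ^ L` polynomials cover all present colours for every prime
    -- `p`.
    set L := 2 ^ j * (b + Nat.clog 2 D + 1) with hL
    have hL0 : D * L ≠ 0 := by positivity
    obtain ⟨p, hp, hlt, hle⟩ := Nat.exists_prime_lt_and_le_two_mul (D * L) hL0
    have : Fact p.Prime := ⟨hp⟩
    obtain ⟨Ψ, hΨ⟩ := exists_colorReduction p L D hlt
    refine ⟨_, (hloc.colorStep hN (hNs.mono (Nat.le_add_right s k))
      fun c A => (Ψ c A).1.val * p + (Ψ c A).2.val), fun E hE h1 h2 => ?_⟩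
    obtain ⟨h3, h4⟩ := hcol' E hE h1 h2
    have h5 := hΨ (N E) (col' E) hE h3 fun v =>
      (h4 v).trans_le (Nat.pow_le_pow_left hp.two_le L)
    have hv : ∀ z : ZMod p, z.val < p := fun z => ZMod.val_lt z
    constructor
    · intro v u hu heq
      refine h5 v u hu ?_
      beta_reduce at heq ⊢
      generalize Ψ (col' E u) _ = x at *
      generalize Ψ (col' E v) _ = y at *
      have hxy : x.1.val = y.1.val := by
        have := congrArg (· / p) heq
        simpa [Nat.add_div_of_dvd_right, hp.pos, Nat.div_eq_of_lt (hv _)] using this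
      rw [hxy] at heq
      exact Prod.ext (ZMod.val_injective p hxy) (ZMod.val_injective p (by omega))
    · intro v
      rw [Function.iterate_succ_apply', ← hb]
      refine lt_of_lt_of_le ?_ (linial_bound hj hle)
      have h6 := hv (Ψ (col' E v) ((N E v).image (col' E))).1
      have h7 := hv (Ψ (col' E v) ((N E v).image (col' E))).2
      nlinarith

/-! ### Additive-group colouring -/

section AdditiveGroup

variable {p : ℕ}

/-- One round of additive-group colouring: a colour `(a, b)` moves to `(a, a + b)` as long as some
neighbour has the same second coordinate, and is finalized to `(0, b)` otherwise. -/
def agStep (c : ZMod p × ZMod p) (A : Finset (ZMod p × ZMod p)) : ZMod p × ZMod p :=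
  open Classical in if ∃ a ∈ A, a.2 = c.2 then (c.1, c.1 + c.2) else (0, c.2)

/-- `t` rounds of additive-group colouring. -/
def agIterate (N : ℕ → Finset ℕ) (col : ℕ → ZMod p × ZMod p) : ℕ → ℕ → ZMod p × ZMod p
  | 0 => col
  | t + 1 => fun v => agStep (agIterate N col t v) ((N v).image (agIterate N col t))

theorem agIterate_succ (N : ℕ → Finset ℕ) (col : ℕ → ZMod p × ZMod p) (t v : ℕ) :
    agIterate N col (t + 1) v = open Classical in
      if ∃ u ∈ N v, (agIterate N col t u).2 = (agIterate N col t v).2 then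
        ((agIterate N col t v).1, (agIterate N col t v).1 + (agIterate N col t v).2)
      else (0, (agIterate N col t v).2) := by
  simp only [agIterate, agStep, Finset.exists_mem_image]

theorem IsLocal.agIterate {s : ℕ}
    {N : Finset (Finset ℕ) → ℕ → Finset ℕ} {col : Finset (Finset ℕ) → ℕ → ZMod p × ZMod p}
    (hN : IsOneHop N) (hNs : IsLocal s N) (hcol : IsLocal s col) (t : ℕ) :
    IsLocal (s + t) fun E => HypergraphMIS.agIterate (N E) (col E) t := by
  induction t with
  | zero => exact hcol
  | succ t ih => exact ih.colorStep hN (hNs.mono (Nat.le_add_right s t)) agStep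

variable {D : ℕ} {N : ℕ → Finset ℕ} {col : ℕ → ZMod p × ZMod p}

/-- Two moving nodes keep their difference. If the new colours agree and one node finalizes, the
second coordinate of the other did not change, so the finalizing node would have been in conflict.
-/
theorem agIterate_proper (hN : IsGraph D N) (hcol : IsProper N col) (t : ℕ) :
    IsProper N (agIterate N col t) := by
  induction t with
  | zero => exact hcol
  | succ t ih =>
    intro v u hu heq
    have huv := ih v u hu
    rw [agIterate_succ, agIterate_succ] at heq
    generalize hx : agIterate N col t u = x at *
    generalize hy : agIterate N col t v = y at *
    obtain ⟨x1, x2⟩ := x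
    obtain ⟨y1, y2⟩ := y
    split_ifs at heq with h1 h2 h2
    · simp only [Prod.mk.injEq] at heq
      obtain ⟨rfl, h⟩ := heq
      exact huv (by rw [add_left_cancel h])
    · simp only [Prod.mk.injEq] at heq
      obtain ⟨rfl, h⟩ := heq
      exact h2 ⟨u, hu, by rw [hx]; simpa using h⟩
    · simp only [Prod.mk.injEq] at heq
      obtain ⟨h0, h⟩ := heq
      exact h1 ⟨v, hN.symm hu, by rw [hy, h, ← h0]; simp⟩
    · simp only [Prod.mk.injEq] at heq
      exact h2 ⟨u, hu, by rw [hx]; exact heq.2⟩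

theorem agIterate_final_succ {t v : ℕ} (h : (agIterate N col t v).1 = 0) :
    agIterate N col (t + 1) v = agIterate N col t v := by
  rw [agIterate_succ]
  split_ifs
  · exact Prod.ext rfl (by simp [h])
  · exact Prod.ext h.symm rfl

theorem agIterate_final {s t v : ℕ} (hst : s ≤ t) (h : (agIterate N col s v).1 = 0) :
    agIterate N col t v = agIterate N col s v := by
  induction hst with
  | refl => rfl
  | step _ ih => rw [agIterate_final_succ (by rw [ih, h]), ih]

theorem agIterate_running {t v : ℕ} (h : (agIterate N col t v).1 ≠ 0) :
    agIterate N col t v = ((col v).1, (t : ZMod p) * (col v).1 + (col v).2) := by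
  induction t with
  | zero => simp [agIterate]
  | succ t ih =>
    have ht : (agIterate N col t v).1 ≠ 0 := fun h0 => h (by rw [agIterate_final_succ h0, h0])
    rw [agIterate_succ] at h ⊢
    split_ifs with hc
    · rw [ih ht]
      simp only [Prod.mk.injEq, true_and]
      push_cast
      ring
    · simp [hc] at h

/-- After `p` rounds of additive-group colouring all colours are final. -/
theorem agIterate_fst_eq_zero [Fact p.Prime] (hN : IsGraph D N) (hcol : IsProper N col)
    (hp : 2 * D < p) (v : ℕ) : (agIterate N col p v).1 = 0 := by
  classical
  by_contra hv
  have hrun : ∀ t ≤ p, (agIterate N col t v).1 ≠ 0 := fun t ht h0 =>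
    hv (by rw [agIterate_final ht h0, h0])
  set a := (col v).1 with ha
  set b := (col v).2 with hb
  have ha0 : a ≠ 0 := by
    have := hrun p le_rfl
    rwa [agIterate_running this] at this
  have hval : ∀ t ≤ p, agIterate N col t v = (a, (t : ZMod p) * a + b) := fun t ht =>
    agIterate_running (hrun t ht)
  have hconf : ∀ t < p, ∃ u ∈ N v, (agIterate N col t u).2 = (t : ZMod p) * a + b := by
    intro t ht
    by_contra hno
    refine hrun (t + 1) ht ?_
    rw [agIterate_succ, if_neg]
    rw [hval t ht.le]
    exact hno
  -- A neighbour causes at most two conflicts with a moving node: one while it moves, since two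
  -- distinct lines meet at most once, and one after it is final. So `p > 2 * D` rounds contain a
  -- conflict-free one.
  have hcover : Finset.range p ⊆ (N v).biUnion fun u =>
      {t ∈ Finset.range p | (agIterate N col t u).1 ≠ 0 ∧
        (agIterate N col t u).2 = (t : ZMod p) * a + b} ∪
      {t ∈ Finset.range p | (agIterate N col t u).1 = 0 ∧
        (agIterate N col t u).2 = (t : ZMod p) * a + b} := by
    intro t ht
    obtain ⟨u, hu, h⟩ := hconf t (Finset.mem_range.1 ht)
    rw [Finset.mem_biUnion]
    refine ⟨u, hu, ?_⟩
    by_cases h0 : (agIterate N col t u).1 = 0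
    · exact Finset.mem_union_right _ (Finset.mem_filter.2 ⟨ht, h0, h⟩)
    · exact Finset.mem_union_left _ (Finset.mem_filter.2 ⟨ht, h0, h⟩)
  have hcast : ∀ t < p, ∀ t' < p, (t : ZMod p) = t' → t = t' := by
    intro t ht t' ht' h
    rw [ZMod.natCast_eq_natCast_iff'] at h
    rwa [Nat.mod_eq_of_lt ht, Nat.mod_eq_of_lt ht'] at h
  have hcard := (Finset.card_le_card hcover).trans
    (Finset.card_biUnion_le_card_mul (N v) _ 2 fun u hu => ?_)
  · rw [Finset.card_range] at hcard
    have := hN.card_le v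
    omega
  refine (Finset.card_union_le _ _).trans ((add_le_add ?_ ?_).trans_eq one_add_one_eq_two)
  · rw [Finset.card_le_one]
    intro t ht t' ht'
    simp only [Finset.mem_filter, Finset.mem_range] at ht ht'
    obtain ⟨ht, h0, h⟩ := ht
    obtain ⟨ht', h0', h'⟩ := ht'
    rw [agIterate_running h0] at h
    rw [agIterate_running h0'] at h'
    simp only at h h'
    by_cases hne : (col u).1 = a
    · exfalso
      refine hcol v u hu (Prod.ext hne ?_)
      rw [hne] at h
      exact add_left_cancel h
    · have h3 : ((t : ZMod p) - t') * ((col u).1 - a) = 0 := by linear_combination h - h'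
      rcases mul_eq_zero.1 h3 with h3 | h3
      · exact hcast t ht t' ht' (sub_eq_zero.1 h3)
      · exact absurd (sub_eq_zero.1 h3) hne
  · rw [Finset.card_le_one]
    intro t ht t' ht'
    simp only [Finset.mem_filter, Finset.mem_range] at ht ht'
    obtain ⟨ht, h0, h⟩ := ht
    obtain ⟨ht', h0', h'⟩ := ht'
    have hsame : agIterate N col t u = agIterate N col t' u := by
      rcases le_total t t' with hle | hle
      · exact (agIterate_final hle h0).symm
      · exact agIterate_final hle h0'
    rw [hsame, h'] at h
    have h3 : ((t : ZMod p) - t') * a = 0 := by linear_combination -h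
    exact hcast t ht t' ht' (sub_eq_zero.1 ((mul_eq_zero.1 h3).resolve_right ha0))

theorem agIterate_snd_proper [Fact p.Prime] (hN : IsGraph D N) (hcol : IsProper N col)
    (hp : 2 * D < p) : IsProper N fun v => (agIterate N col p v).2.val := by
  intro v u hu heq
  refine agIterate_proper hN hcol p v u hu (Prod.ext ?_ (ZMod.val_injective p heq))
  rw [agIterate_fst_eq_zero hN hcol hp, agIterate_fst_eq_zero hN hcol hp]

end AdditiveGroup

/-- A proper colouring with `2 ^ (2 ^ j * (Nat.clog 2 D + 2))` colours is reduced to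
`p ≤ 16 * 2 ^ j * D` colours in `p + 1` rounds. -/
theorem exists_linear_coloring {s D j : ℕ} (hD : 1 ≤ D)
    {N : Finset (Finset ℕ) → ℕ → Finset ℕ} (hN : IsOneHop N) (hNs : IsLocal s N)
    {col : Finset (Finset ℕ) → ℕ → ℕ} (hcol : IsLocal s col) :
    ∃ p ≤ 16 * 2 ^ j * D, ∃ col' : Finset (Finset ℕ) → ℕ → ℕ, IsLocal (s + (p + 1)) col' ∧
      ∀ E, IsGraph D (N E) → IsProper (N E) (col E) →
        (∀ v, col E v < 2 ^ (2 ^ j * (Nat.clog 2 D + 2))) →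
        IsProper (N E) (col' E) ∧ ∀ v, col' E v < p := by
  -- The factor 8 is needed because `2 ^ (Nat.clog 2 D + 2) ≤ 8 * D`, so that polynomials with `2 ^
  -- j` coefficients cover the colours.
  obtain ⟨p, hp, hlt, hle⟩ := Nat.exists_prime_lt_and_le_two_mul (8 * 2 ^ j * D) (by positivity)
  have : Fact p.Prime := ⟨hp⟩
  have h2j : 1 ≤ 2 ^ j := Nat.one_le_two_pow
  have hDj : D ≤ 2 ^ j * D := Nat.le_mul_of_pos_left D (by omega)
  obtain ⟨Ψ, hΨ⟩ := exists_colorReduction p (2 ^ j) D (by rw [mul_comm]; lia)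
  refine ⟨p, by lia, fun E v => (agIterate (N E) (fun v => Ψ (col E v) ((N E v).image (col E)))
    p v).2.val, ?_, ?_⟩
  · have := (IsLocal.agIterate hN (hNs.mono (Nat.le_add_right s 1))
      (hcol.colorStep hN hNs Ψ) p).map fun c => c.2.val
    rwa [add_assoc, add_comm 1 p] at this
  · intro E hE h1 h2
    have h3 : 2 ^ (Nat.clog 2 D + 2) ≤ p := by
      have h4 : 2 ^ Nat.clog 2 D ≤ 2 * D := by
        rcases Nat.lt_or_ge 1 D with h | h
        · have h5 := Nat.pow_pred_clog_lt_self one_lt_two h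
          have h6 : 0 < Nat.clog 2 D := Nat.clog_pos one_lt_two h
          obtain ⟨m, hm⟩ := Nat.exists_eq_succ_of_ne_zero h6.ne'
          rw [hm] at h5 ⊢
          simp only [Nat.pred_succ, Nat.succ_eq_add_one, pow_succ] at h5 ⊢
          omega
        · have : D = 1 := by omega
          subst this
          simp
      rw [pow_add]
      lia
    have h4 := hΨ (N E) (col E) hE h1 fun v => (h2 v).trans_le (by
      rw [mul_comm, pow_mul]
      exact Nat.pow_le_pow_left h3 _)
    exact ⟨agIterate_snd_proper hE h4 (by lia), fun v => ZMod.val_lt _⟩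

/-! ### Bounded hypergraphs and the primal graph -/

/-- Non-empty hyperedges, degrees at most `Δ`, and hyperedges of size at most `r`. -/
structure IsBounded (Δ r : ℕ) (E : Finset (Finset ℕ)) : Prop where
  nonempty : ∀ e ∈ E, e.Nonempty
  degree_le : ∀ v, {e ∈ E | v ∈ e}.card ≤ Δ
  card_le : ∀ e ∈ E, e.card ≤ r

/-- The nodes that share a hyperedge with `v`. -/
def primalNeighbors (E : Finset (Finset ℕ)) (v : ℕ) : Finset ℕ :=
  ({e ∈ E | v ∈ e}.biUnion id).erase v

theorem mem_primalNeighbors {E : Finset (Finset ℕ)} {u v : ℕ} :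
    u ∈ primalNeighbors E v ↔ u ≠ v ∧ ∃ e ∈ E, v ∈ e ∧ u ∈ e := by
  simp [primalNeighbors, and_assoc]

theorem isOneHop_primalNeighbors : IsOneHop primalNeighbors := fun _ _ _ hu =>
  (mem_primalNeighbors.1 hu).2

theorem isLocal_primalNeighbors : IsLocal 1 primalNeighbors := by
  refine IsLocal.step (IsLocal.of_id 0 fun _ => ()) ?_
  intro E E' v hE _ _
  ext u
  simp only [mem_primalNeighbors]
  refine and_congr_right fun _ => exists_congr fun e => ?_
  constructor
  · rintro ⟨h1, h2, h3⟩
    exact ⟨(hE e h2).1 h1, h2, h3⟩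
  · rintro ⟨h1, h2, h3⟩
    exact ⟨(hE e h2).2 h1, h2, h3⟩

theorem IsBounded.isGraph_primalNeighbors {Δ r : ℕ} {E : Finset (Finset ℕ)}
    (hE : IsBounded Δ r E) : IsGraph (Δ * r) (primalNeighbors E) where
  symm u v h := by
    obtain ⟨h0, e, he, hv, hu⟩ := mem_primalNeighbors.1 h
    exact mem_primalNeighbors.2 ⟨h0.symm, e, he, hu, hv⟩
  irrefl v h := (mem_primalNeighbors.1 h).1 rfl
  card_le v := by
    refine (Finset.card_erase_le).trans ((Finset.card_biUnion_le_card_mul _ _ r ?_).trans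
      (Nat.mul_le_mul_right r (hE.degree_le v)))
    intro e he
    exact hE.card_le e (Finset.mem_filter.1 he).1

/-! ### Pairing the elements of a finite set -/

section Mate

theorem exists_mate (A : Finset ℕ) : ∃ π : ℕ → ℕ, (∀ x ∈ A, π x ∈ A) ∧
    (∀ x ∈ A, π (π x) = x) ∧ {x ∈ A | π x = x}.card ≤ 1 := by
  induction A using Finset.strongInduction with
  | H A ih =>
    rcases Nat.lt_or_ge 1 A.card with h | h
    · obtain ⟨x, hx, y, hy, hxy⟩ := Finset.one_lt_card.1 h
      have hss : (A.erase x).erase y ⊂ A :=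
        (Finset.erase_subset _ _).trans_ssubset (Finset.erase_ssubset hx)
      obtain ⟨π, h1, h2, h3⟩ := ih _ hss
      simp only [Finset.mem_erase] at h1 h2
      refine ⟨fun z => if z = x then y else if z = y then x else π z, ?_, ?_, ?_⟩
      · intro z hz
        grind
      · intro z hz
        grind
      · refine le_trans (Finset.card_le_card ?_) h3
        intro z hz
        simp only [Finset.mem_filter, Finset.mem_erase] at hz ⊢
        grind
    · exact ⟨id, fun x hx => hx, fun x _ => rfl, (Finset.card_filter_le _ _).trans h⟩

/-- A partition of a finite set into pairs, with at most one singleton, as an involution. -/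
noncomputable def mate (A : Finset ℕ) : ℕ → ℕ := (exists_mate A).choose

theorem mate_mem {A : Finset ℕ} {x : ℕ} (hx : x ∈ A) : mate A x ∈ A :=
  (exists_mate A).choose_spec.1 x hx

theorem mate_mate {A : Finset ℕ} {x : ℕ} (hx : x ∈ A) : mate A (mate A x) = x :=
  (exists_mate A).choose_spec.2.1 x hx

/-- Apart from the at most one fixed point, `mate A` injects `J` into its complement. -/
theorem two_mul_card_le_of_mate {A J : Finset ℕ} (hJ : J ⊆ A)
    (h : ∀ x ∈ J, mate A x ∈ J → mate A x = x) : 2 * J.card ≤ A.card + 1 := by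
  have h1 : {x ∈ J | mate A x = x}.card ≤ 1 :=
    (Finset.card_le_card (Finset.filter_subset_filter _ hJ)).trans
      (exists_mate A).choose_spec.2.2
  have h2 : {x ∈ J | ¬ mate A x = x}.card ≤ (A \ J).card := by
    refine Finset.card_le_card_of_injOn (mate A) ?_ ?_
    · intro x hx
      obtain ⟨hx, hne⟩ := Finset.mem_filter.1 hx
      exact Finset.mem_coe.2 (Finset.mem_sdiff.2 ⟨mate_mem (hJ hx), fun hm => hne (h x hx hm)⟩)
    · intro x hx y hy hxy
      have hx := hJ (Finset.mem_filter.1 hx).1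
      have hy := hJ (Finset.mem_filter.1 hy).1
      rw [← mate_mate hx, hxy, mate_mate hy]
  have h3 := Finset.card_filter_add_card_filter_not (s := J) (fun x => mate A x = x)
  have h4 := Finset.card_sdiff_add_card_eq_card hJ
  omega

end Mate

/-! ### One phase -/

section Phase

open scoped Classical

variable (E : Finset (Finset ℕ)) (S : ℕ → Prop)

/-- No hyperedge is contained in `S`. -/
def Independent : Prop := ∀ e ∈ E, ∃ u ∈ e, ¬ S u

/-- Some hyperedge lies in `S` except for the node `v`. -/
def Blocked (v : ℕ) : Prop := ¬ S v ∧ ∃ e ∈ E, v ∈ e ∧ ∀ u ∈ e, u ≠ v → S u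

/-- The node is neither in `S` nor blocked. -/
def Undecided (v : ℕ) : Prop := ¬ S v ∧ ¬ Blocked E S v

/-- The hyperedge contains no blocked node. -/
def Alive (e : Finset ℕ) : Prop := ∀ u ∈ e, ¬ Blocked E S u

/-- The nodes of a hyperedge outside `S`. -/
noncomputable def free (e : Finset ℕ) : Finset ℕ := {u ∈ e | ¬ S u}

/-- The mates of `v` in the alive hyperedges. -/
noncomputable def mates (v : ℕ) : Finset ℕ :=
  ({e ∈ E | v ∈ e ∧ ¬ S v ∧ Alive E S e}.image fun e => mate (free S e) v).erase v

/-- The set of nodes selected when colour classes `0, …, i - 1` have been processed: a node is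
selected unless some alive hyperedge has at least a quarter of its free nodes selected. -/
def Selected (col : ℕ → ℕ) : ℕ → ℕ → Prop
  | 0 => fun _ => False
  -- Undecided, alive and free refer to the set at the start of the phase; only the selected count
  -- evolves.
  | i + 1 => fun v => Selected col i v ∨ (col v = i ∧ Undecided E S v ∧
      ∀ e ∈ E, v ∈ e → Alive E S e → 4 * {u ∈ e | Selected col i u}.card < (free S e).card)

/-- The potential of a node. -/
noncomputable def potential (v : ℕ) : ℕ :=
  ∑ e ∈ E with v ∈ e ∧ Alive E S e, Nat.log 2 ((free S e).card ^ 3)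

variable {E S}

theorem mem_free {e : Finset ℕ} {u : ℕ} : u ∈ free S e ↔ u ∈ e ∧ ¬ S u := by simp [free]

theorem mem_mates {u v : ℕ} : u ∈ mates E S v ↔
    u ≠ v ∧ ∃ e ∈ E, (v ∈ e ∧ ¬ S v ∧ Alive E S e) ∧ mate (free S e) v = u := by
  simp [mates, and_assoc]

theorem mates_subset (v : ℕ) : mates E S v ⊆ primalNeighbors E v := by
  intro u hu
  obtain ⟨h0, e, he, ⟨hv, hSv, -⟩, rfl⟩ := mem_mates.1 hu
  exact mem_primalNeighbors.2 ⟨h0, e, he, hv, (mem_free.1 (mate_mem (mem_free.2 ⟨hv, hSv⟩))).1⟩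

/-- Symmetry holds because `mate` depends only on the free set, so both ends agree on the pairing.
-/
theorem IsBounded.isGraph_mates {Δ r : ℕ} (hE : IsBounded Δ r E) : IsGraph Δ (mates E S) where
  symm u v h := by
    obtain ⟨h0, e, he, ⟨hv, hSv, hal⟩, rfl⟩ := mem_mates.1 h
    have hm := mem_free.1 (mate_mem (mem_free.2 ⟨hv, hSv⟩))
    exact mem_mates.2 ⟨h0.symm, e, he, ⟨hm.1, hm.2, hal⟩, mate_mate (mem_free.2 ⟨hv, hSv⟩)⟩
  irrefl v h := (mem_mates.1 h).1 rfl
  card_le v := by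
    refine Finset.card_erase_le.trans (Finset.card_image_le.trans
      ((Finset.card_le_card ?_).trans (hE.degree_le v)))
    exact Finset.monotone_filter_right _ fun e _ h => h.1

/-- A sole free node would be blocked. -/
theorem two_le_card_free (hS : Independent E S) {e : Finset ℕ} (he : e ∈ E)
    (hal : Alive E S e) : 2 ≤ (free S e).card := by
  obtain ⟨u, hu, hSu⟩ := hS e he
  by_contra hlt
  refine hal u hu ⟨hSu, e, he, hu, fun w hw hwu => ?_⟩
  by_contra hSw
  exact hwu (Finset.card_le_one.1 (by omega) w (mem_free.2 ⟨hw, hSw⟩) u (mem_free.2 ⟨hu, hSu⟩))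

section Selected

variable {col : ℕ → ℕ}

theorem Selected.undecided {i v : ℕ} (h : Selected E S col i v) : Undecided E S v := by
  induction i with
  | zero => exact h.elim
  | succ i ih => exact h.elim ih fun h => h.2.1

theorem Selected.mono {i k v : ℕ} (hik : i ≤ k) (h : Selected E S col i v) :
    Selected E S col k v := by
  induction hik with
  | refl => exact h
  | step _ ih => exact Or.inl ih

/-- Let f be the free count. Selection continues only below f/4, and a colour class holds at most
one node of each pair, so at most (f + 1)/2 free nodes. The total is at most (3f + 1)/4, which is
below f since f ≥ 2. -/
theorem card_selected_lt (hS : Independent E S) (hcol : IsProper (mates E S) col) {e : Finset ℕ}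
    (he : e ∈ E) (hal : Alive E S e) (i : ℕ) :
    {u ∈ e | Selected E S col i u}.card < (free S e).card := by
  have h2 := two_le_card_free hS he hal
  induction i with
  | zero =>
    have h0 : {u ∈ e | Selected E S col 0 u} = ∅ := Finset.filter_eq_empty_iff.2 fun _ _ => id
    rw [h0]
    exact Nat.lt_of_lt_of_le Nat.zero_lt_two h2
  | succ i ih =>
    by_cases hsat : 4 * {u ∈ e | Selected E S col i u}.card < (free S e).card
    · have hJ : 2 * {u ∈ free S e | col u = i}.card ≤ (free S e).card + 1 := by
        refine two_mul_card_le_of_mate (Finset.filter_subset _ _) fun x hx hm => ?_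
        by_contra hne
        obtain ⟨hx, hxi⟩ := Finset.mem_filter.1 hx
        refine hcol x _ (mem_mates.2 ⟨hne, e, he, ⟨(mem_free.1 hx).1, (mem_free.1 hx).2, hal⟩,
          rfl⟩) ?_
        rw [(Finset.mem_filter.1 hm).2, hxi]
      have hsub : {u ∈ e | Selected E S col (i + 1) u} ⊆
          {u ∈ e | Selected E S col i u} ∪ {u ∈ free S e | col u = i} := by
        intro u hu
        obtain ⟨hue, h | h⟩ := Finset.mem_filter.1 hu
        · exact Finset.mem_union_left _ (Finset.mem_filter.2 ⟨hue, h⟩)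
        · exact Finset.mem_union_right _
            (Finset.mem_filter.2 ⟨mem_free.2 ⟨hue, h.2.1.1⟩, h.1⟩)
      have := (Finset.card_le_card hsub).trans (Finset.card_union_le _ _)
      omega
    · refine lt_of_le_of_lt (Finset.card_le_card fun u hu => ?_) ih
      obtain ⟨hue, h | h⟩ := Finset.mem_filter.1 hu
      · exact Finset.mem_filter.2 ⟨hue, h⟩
      · exact absurd (h.2.2 e he hue hal) hsat

theorem card_free_or_selected {e : Finset ℕ} (i : ℕ) :
    (free (fun v => S v ∨ Selected E S col i v) e).card +
      {u ∈ e | Selected E S col i u}.card = (free S e).card := by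
  rw [← Finset.card_filter_add_card_filter_not (s := free S e) (fun u => Selected E S col i u),
    add_comm]
  congr 2
  · ext u
    simp only [Finset.mem_filter, mem_free]
    exact ⟨fun h => ⟨⟨h.1, h.2.undecided.1⟩, h.2⟩, fun h => ⟨h.1.1, h.2⟩⟩
  · ext u
    simp only [Finset.mem_filter, mem_free]
    tauto

theorem independent_or_selected (hS : Independent E S) (hcol : IsProper (mates E S) col) (i : ℕ) :
    Independent E fun v => S v ∨ Selected E S col i v := by
  intro e he
  by_cases hal : Alive E S e
  · have h1 := card_selected_lt hS hcol he hal i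
    have h2 := card_free_or_selected (E := E) (S := S) (col := col) (e := e) i
    obtain ⟨u, hu⟩ := Finset.card_pos.1 (show 0 <
      (free (fun v => S v ∨ Selected E S col i v) e).card by omega)
    exact ⟨u, mem_free.1 hu⟩
  -- A blocked node is outside `S` and is never selected.
  · simp only [Alive, not_forall, not_not] at hal
    obtain ⟨u, hu, hb⟩ := hal
    exact ⟨u, hu, fun h => h.elim hb.1 fun h => h.undecided.2 hb⟩

theorem Blocked.or_selected {v : ℕ} (h : Blocked E S v) (i : ℕ) :
    Blocked E (fun v => S v ∨ Selected E S col i v) v := by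
  refine ⟨fun h' => h'.elim h.1 fun h' => h'.undecided.2 h, ?_⟩
  obtain ⟨-, e, he, hv, hu⟩ := h
  exact ⟨e, he, hv, fun u hue hne => Or.inl (hu u hue hne)⟩

theorem Undecided.of_or_selected {v i : ℕ}
    (h : Undecided E (fun v => S v ∨ Selected E S col i v) v) : Undecided E S v :=
  ⟨fun h' => h.1 (Or.inl h'), fun h' => h.2 (h'.or_selected i)⟩

/-- When its colour was processed, only a saturated hyperedge could have kept the node out;
saturation persists as the selection grows. -/
theorem exists_saturated {v p : ℕ} (hv : Undecided E S v) (hsel : ¬ Selected E S col p v)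
    (hp : col v < p) : ∃ e ∈ E, v ∈ e ∧ Alive E S e ∧
      (free S e).card ≤ 4 * {u ∈ e | Selected E S col p u}.card := by
  by_contra! hcon
  refine hsel (Selected.mono (Nat.succ_le_of_lt hp) (Or.inr ⟨rfl, hv, fun e he hve hal => ?_⟩))
  refine lt_of_le_of_lt ?_ (hcon e he hve hal)
  refine Nat.mul_le_mul_left 4 (Finset.card_le_card ?_)
  exact Finset.monotone_filter_right _ fun u _ h => Selected.mono hp.le h

/-- Since (3/4)³ = 27/64 < 1/2, cubing makes the integer logarithm drop by at least one. -/
theorem log_cube_lt {k k' : ℕ} (hk : 2 ≤ k) (h : 4 * k' ≤ 3 * k) :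
    Nat.log 2 (k' ^ 3) < Nat.log 2 (k ^ 3) := by
  have h8 : 2 ^ 3 ≤ k ^ 3 := Nat.pow_le_pow_left hk 3
  rcases Nat.eq_zero_or_pos k' with rfl | hpos
  · have := Nat.log_mono_right (b := 2) h8
    rw [Nat.log_pow one_lt_two] at this
    simp
    omega
  · have h1 : (4 * k') ^ 3 ≤ (3 * k) ^ 3 := Nat.pow_le_pow_left h 3
    rw [mul_pow, mul_pow] at h1
    have h2 : k' ^ 3 * 2 ≤ k ^ 3 := by omega
    have h3 := Nat.log_mono_right (b := 2) h2
    rw [Nat.log_mul_base one_lt_two (by positivity)] at h3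
    omega

theorem potential_or_selected_lt {v p : ℕ} (hS : Independent E S) (hp : col v < p)
    (hv : Undecided E (fun v => S v ∨ Selected E S col p v) v) :
    potential E (fun v => S v ∨ Selected E S col p v) v < potential E S v := by
  obtain ⟨e, he, hve, hal, hsat⟩ := exists_saturated hv.of_or_selected
    (fun h => hv.1 (Or.inr h)) hp
  have hcard := fun e => card_free_or_selected (E := E) (S := S) (col := col) (e := e) p
  set S' : ℕ → Prop := fun v => S v ∨ Selected E S col p v with hS'
  have halive : ∀ e, Alive E S' e → Alive E S e := fun e h u hu hb =>
    h u hu (hb.or_selected p)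
  calc potential E S' v
      -- Blocked nodes stay blocked, so no hyperedge becomes alive again; those that die contribute
      -- zero.
      = ∑ e ∈ E with v ∈ e ∧ Alive E S e,
          if Alive E S' e then Nat.log 2 ((free S' e).card ^ 3) else 0 := by
        rw [potential, ← Finset.sum_filter, Finset.filter_filter]
        refine Finset.sum_congr (Finset.filter_congr fun e _ => ?_) fun _ _ => rfl
        exact ⟨fun h => ⟨⟨h.1, halive e h.2⟩, h.2⟩, fun h => ⟨h.1.1, h.2⟩⟩
    _ < potential E S v := by
        refine Finset.sum_lt_sum (fun f _ => ?_) ⟨e, Finset.mem_filter.2 ⟨he, hve, hal⟩, ?_⟩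
        · split_ifs
          · refine Nat.log_mono_right (Nat.pow_le_pow_left ?_ 3)
            have := hcard f
            omega
          · exact Nat.zero_le _
        · have h1 := hcard e
          have h2 := two_le_card_free hS he hal
          split_ifs
          · exact log_cube_lt h2 (by omega)
          · simpa using log_cube_lt (k' := 0) h2 (by omega)

end Selected

section Locality

variable {s : ℕ} {S : Finset (Finset ℕ) → ℕ → Prop}

theorem IsLocal.blocked (hS : IsLocal s S) :
    IsLocal (s + 1) fun E => Blocked E (S E) := by
  refine hS.step fun E E' v hE hv he => ?_
  simp only [Blocked, hv, eq_iff_iff]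
  refine and_congr_right fun _ => exists_congr fun e => ?_
  constructor
  · rintro ⟨h1, h2, h3⟩
    exact ⟨(hE e h2).1 h1, h2, fun u hu hne => he e h1 h2 u hu ▸ h3 u hu hne⟩
  · rintro ⟨h1, h2, h3⟩
    have h1 := (hE e h2).2 h1
    exact ⟨h1, h2, fun u hu hne => (he e h1 h2 u hu).symm ▸ h3 u hu hne⟩

theorem free_congr {E E' : Finset (Finset ℕ)} {e : Finset ℕ} (h : ∀ u ∈ e, S E u = S E' u) :
    free (S E) e = free (S E') e :=
  Finset.filter_congr fun u hu => by rw [h u hu]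

theorem alive_congr {E E' : Finset (Finset ℕ)} {e : Finset ℕ}
    (h : ∀ u ∈ e, Blocked E (S E) u = Blocked E' (S E') u) :
    Alive E (S E) e ↔ Alive E' (S E') e :=
  forall₂_congr fun u hu => by rw [h u hu]

/-- One round determines who is blocked, and a second spreads this within the hyperedges. -/
theorem IsLocal.mates (hS : IsLocal s S) :
    IsLocal (s + 2) fun E => mates E (S E) := by
  refine IsLocal.step ((hS.mono (Nat.le_succ s)).map₂ hS.blocked Prod.mk)
    fun E E' v hE hv he => ?_
  simp only [Prod.mk.injEq] at hv he
  ext u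
  simp only [mem_mates]
  refine and_congr_right fun _ => exists_congr fun e => ?_
  rw [hv.1]
  constructor
  · rintro ⟨h1, ⟨h2, h3, h4⟩, h5⟩
    refine ⟨(hE e h2).1 h1, ⟨h2, h3, ?_⟩, ?_⟩
    · exact (alive_congr fun u hu => (he e h1 h2 u hu).2).1 h4
    · rwa [← free_congr fun u hu => (he e h1 h2 u hu).1]
  · rintro ⟨h1, ⟨h2, h3, h4⟩, h5⟩
    have h1 := (hE e h2).2 h1
    refine ⟨h1, ⟨h2, h3, ?_⟩, ?_⟩
    · exact (alive_congr fun u hu => (he e h1 h2 u hu).2).2 h4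
    · rwa [free_congr fun u hu => (he e h1 h2 u hu).1]

theorem IsLocal.selected {col : Finset (Finset ℕ) → ℕ → ℕ} {t : ℕ}
    (hS : IsLocal s S) (hst : s + 1 ≤ t) (hcol : IsLocal t col) (i : ℕ) :
    IsLocal (t + i) fun E => Selected E (S E) (col E) i := by
  induction i with
  | zero => exact fun _ _ _ _ _ => rfl
  | succ i ih =>
    refine IsLocal.step ((((hS.mono (t := t + i) (by omega)).map₂
      (hS.blocked.mono (by omega)) Prod.mk).map₂
      (hcol.mono (Nat.le_add_right t i)) Prod.mk).map₂ ih Prod.mk) fun E E' v hE hv he => ?_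
    simp only [Prod.mk.injEq] at hv he
    simp only [Selected, Undecided, hv, eq_iff_iff]
    refine or_congr_right (and_congr_right fun _ => and_congr_right fun _ =>
      forall_congr' fun e => ?_)
    have key : e ∈ E → v ∈ e → ((Alive E (S E) e →
        4 * {u ∈ e | Selected E (S E) (col E) i u}.card < (free (S E) e).card) ↔
        (Alive E' (S E') e →
        4 * {u ∈ e | Selected E' (S E') (col E') i u}.card < (free (S E') e).card)) := by
      intro h1 h2
      have h3 : {u ∈ e | Selected E (S E) (col E) i u} =
          {u ∈ e | Selected E' (S E') (col E') i u} :=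
        Finset.filter_congr fun u hu => by rw [(he e h1 h2 u hu).2]
      rw [alive_congr fun u hu => (he e h1 h2 u hu).1.1.2,
        free_congr fun u hu => (he e h1 h2 u hu).1.1.1, h3]
    constructor
    · intro h h1 h2
      have h1 := (hE e h2).2 h1
      exact (key h1 h2).1 (h h1 h2)
    · intro h h1 h2
      exact (key h1 h2).2 (h ((hE e h2).1 h1) h2)

end Locality

end Phase

/-! ### Iterating the phases -/

/-- One phase: the potential of every node that stays undecided drops. -/
theorem exists_phase {s₀ s Δ r j k : ℕ} (hΔ : 1 ≤ Δ) (hj : 4 ≤ j)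
    (hk : (Nat.clog 2)^[k] (Nat.clog 2 r) ≤ 1) {base : Finset (Finset ℕ) → ℕ → ℕ}
    (hbase : IsLocal s₀ base) (hs : s₀ ≤ s) {S : Finset (Finset ℕ) → ℕ → Prop}
    (hS : IsLocal s S) :
    ∃ S' : Finset (Finset ℕ) → ℕ → Prop, IsLocal (s + (3 + k + 32 * 2 ^ j * Δ)) S' ∧
      ∀ E, IsBounded Δ r E → IsProper (primalNeighbors E) (base E) →
        (∀ v, base E v < 2 ^ (2 ^ j * (Nat.clog 2 r + Nat.clog 2 Δ + 1))) →
        Independent E (S E) → Independent E (S' E) ∧ ∀ v, Undecided E (S' E) v →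
          Undecided E (S E) v ∧ potential E (S' E) v < potential E (S E) v := by
  have hone : IsOneHop fun E => mates E (S E) := fun E v u hu =>
    isOneHop_primalNeighbors E v u (mates_subset v hu)
  obtain ⟨col₁, hloc₁, hcol₁⟩ := exists_linial_iterate (b₀ := Nat.clog 2 r) hΔ hj hone hS.mates
    (hbase.mono (show s₀ ≤ s + 2 by omega)) k
  obtain ⟨p, hp, col, hloc, hcol⟩ := exists_linear_coloring (j := j) hΔ hone
    (hS.mates.mono (Nat.le_add_right _ k)) hloc₁
  refine ⟨fun E v => S E v ∨ Selected E (S E) (col E) p v, ?_, fun E hE hprop hlt hind => ?_⟩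
  -- Two rounds for the mates, `k` for Linial, `p + 1` for the linear colouring, and `p` for the
  -- colour classes.
  · refine ((hS.mono (t := s + 2 + k + (p + 1) + p) (by omega)).map₂
      (hS.selected (by omega) hloc p) Or).mono ?_
    have : 32 * 2 ^ j * Δ = 2 * (16 * 2 ^ j * Δ) := by ring
    omega
  · have hG : IsGraph Δ (mates E (S E)) := hE.isGraph_mates
    obtain ⟨h1, h2⟩ := hcol₁ E hG (fun v u hu => hprop v u (mates_subset v hu)) hlt
    obtain ⟨h3, h4⟩ := hcol E hG h1 fun v => (h2 v).trans_le (Nat.pow_le_pow_right two_pos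
      (Nat.mul_le_mul_left _ (by omega)))
    exact ⟨independent_or_selected hind h3 p, fun v hv =>
      ⟨hv.of_or_selected, potential_or_selected_lt hind (h4 v) hv⟩⟩

theorem IsBounded.potential_le {Δ r : ℕ} {E : Finset (Finset ℕ)} (hE : IsBounded Δ r E)
    (S : ℕ → Prop) (v : ℕ) : potential E S v ≤ Δ * Nat.log 2 (r ^ 3) := by
  classical
  refine (Finset.sum_le_card_nsmul _ _ (Nat.log 2 (r ^ 3)) fun e he => ?_).trans ?_
  · refine Nat.log_mono_right (Nat.pow_le_pow_left ?_ 3)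
    exact (Finset.card_filter_le _ _).trans (hE.card_le e (Finset.mem_filter.1 he).1)
  · rw [smul_eq_mul]
    refine Nat.mul_le_mul_right _ (le_trans (Finset.card_le_card ?_) (hE.degree_le v))
    exact Finset.monotone_filter_right _ fun e _ h => h.1

theorem exists_phases {s₀ Δ r j k : ℕ} (hΔ : 1 ≤ Δ) (hj : 4 ≤ j)
    (hk : (Nat.clog 2)^[k] (Nat.clog 2 r) ≤ 1) {base : Finset (Finset ℕ) → ℕ → ℕ}
    (hbase : IsLocal s₀ base) (q : ℕ) :
    ∃ S : Finset (Finset ℕ) → ℕ → Prop, IsLocal (s₀ + q * (3 + k + 32 * 2 ^ j * Δ)) S ∧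
      ∀ E, IsBounded Δ r E → IsProper (primalNeighbors E) (base E) →
        (∀ v, base E v < 2 ^ (2 ^ j * (Nat.clog 2 r + Nat.clog 2 Δ + 1))) →
        Independent E (S E) ∧ ∀ v, Undecided E (S E) v →
          potential E (S E) v + q ≤ Δ * Nat.log 2 (r ^ 3) := by
  induction q with
  | zero =>
    refine ⟨fun _ _ => False, IsLocal.of_id _ fun _ => False, fun E hE _ _ => ⟨fun e he => ?_,
      fun v _ => hE.potential_le _ v⟩⟩
    obtain ⟨u, hu⟩ := hE.nonempty e he
    exact ⟨u, hu, id⟩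
  | succ q ih =>
    obtain ⟨S, hloc, hS⟩ := ih
    obtain ⟨S', hloc', hS'⟩ := exists_phase hΔ hj hk hbase (Nat.le_add_right _ _) hloc
    refine ⟨S', by rwa [add_assoc, ← Nat.succ_mul] at hloc', fun E hE h1 h2 => ?_⟩
    obtain ⟨h3, h4⟩ := hS E hE h1 h2
    obtain ⟨h5, h6⟩ := hS' E hE h1 h2 h3
    refine ⟨h5, fun v hv => ?_⟩
    have h7 := h4 v (h6 v hv).1
    have h8 := (h6 v hv).2
    omega

/-! ### The iterated logarithm -/

section LogStar

/-- This keeps the infimum in `logStar` from being the default value of an empty set. -/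
theorem exists_iterate_logb_le_one (m : ℕ) (y : ℝ) (hy : y ≤ m) :
    ∃ k, (Real.logb 2)^[k] y ≤ 1 := by
  induction m generalizing y with
  | zero => exact ⟨0, by simp at hy ⊢; linarith⟩
  | succ m ih =>
    rcases le_or_gt y 1 with h | h
    · exact ⟨0, h⟩
    · obtain ⟨k, hk⟩ := ih (Real.logb 2 y) (by
        rw [Real.logb_le_iff_le_rpow one_lt_two (by linarith), Real.rpow_natCast]
        refine hy.trans ?_
        have : m + 1 ≤ 2 ^ m := Nat.lt_two_pow_self
        exact_mod_cast this)
      exact ⟨k + 1, hk⟩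

theorem iterate_clog_zero (k : ℕ) : (Nat.clog 2)^[k] 0 = 0 :=
  Function.iterate_fixed (Nat.clog_zero_right 2) k

/-- Above 1, `Nat.clog 2` of the ceiling is the ceiling of the logarithm. From `y ≤ 1` on, the
integer iteration stays at 0, whatever the real one does. -/
theorem iterate_clog_ceil_le_one (k : ℕ) (y : ℝ) (hy : (Real.logb 2)^[k] y ≤ 1) :
    (Nat.clog 2)^[k] ⌈y⌉₊ ≤ 1 := by
  induction k generalizing y with
  | zero => simpa using hy
  | succ k ih =>
    rw [Function.iterate_succ_apply]
    rcases le_or_gt y 1 with h | h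
    · have h1 : ⌈y⌉₊ ≤ 1 := by simpa using h
      rw [Nat.clog_of_right_le_one h1, iterate_clog_zero]
      exact Nat.zero_le 1
    · have h1 : Nat.clog 2 ⌈y⌉₊ = ⌈Real.logb 2 y⌉₊ := by
        refine eq_of_forall_ge_iff fun m => ?_
        rw [Nat.clog_le_iff_le_pow one_lt_two, Nat.ceil_le, Nat.ceil_le,
          Real.logb_le_iff_le_rpow one_lt_two (by linarith), Real.rpow_natCast]
        norm_cast
      rw [h1]
      exact ih _ hy

theorem iterate_clog_logStar_le_one (n : ℕ) : (Nat.clog 2)^[logStar n] (Nat.clog 2 n) ≤ 1 := by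
  have h1 : (Real.logb 2)^[logStar n] (n : ℝ) ≤ 1 :=
    Nat.sInf_mem (s := {k : ℕ | (Real.logb 2)^[k] (n : ℝ) ≤ 1})
      (exists_iterate_logb_le_one n n le_rfl)
  have h2 := iterate_clog_ceil_le_one _ _ h1
  rw [Nat.ceil_natCast] at h2
  rw [← Function.iterate_succ_apply, Function.iterate_succ_apply']
  rw [Nat.clog_of_right_le_one h2]
  exact Nat.zero_le 1

end LogStar

/-! ### The number of rounds -/

/-- The parameter `j` of the colour bounds exists to absorb the exponent `c` of the identifier
range. -/
theorem clog_mul_bound {c n l : ℕ} : n ^ c < 2 ^ (2 ^ (c + 4) * (Nat.clog 2 n + l + 1)) := by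
  have h1 : n ^ c ≤ 2 ^ (Nat.clog 2 n * c) := by
    rw [pow_mul]
    exact Nat.pow_le_pow_left (Nat.le_pow_clog one_lt_two n) c
  refine h1.trans_lt (Nat.pow_lt_pow_right one_lt_two ?_)
  have h2 : c < 2 ^ (c + 4) := Nat.lt_two_pow_self.trans_le
    (Nat.pow_le_pow_right two_pos (Nat.le_add_right c 4))
  nlinarith [Nat.zero_le (Nat.clog 2 n), Nat.zero_le l]

/-- The number of rounds of the algorithm. -/
noncomputable def rounds (c n Δ r : ℕ) : ℕ :=
  1 + logStar n + (Δ * Nat.log 2 (r ^ 3) + 1) * (3 + logStar r + 32 * 2 ^ (c + 5) * Δ)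

/-- The side conditions stand under the existential so that `S` can be chosen as a function of all
parameters. -/
theorem exists_local_mis (c n Δ r : ℕ) : ∃ S : Finset (Finset ℕ) → ℕ → Prop, 2 ≤ r → 1 ≤ Δ →
    IsLocal (rounds c n Δ r) S ∧ ∀ E, IsBounded Δ r E → (∀ e ∈ E, ∀ u ∈ e, u ≤ n ^ c) →
      Independent E (S E) ∧ ∀ v, ¬ Undecided E (S E) v := by
  by_cases h : 2 ≤ r ∧ 1 ≤ Δ
  swap
  · exact ⟨fun _ _ => True, fun h1 h2 => absurd ⟨h1, h2⟩ h⟩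
  obtain ⟨hr, hΔ⟩ := h
  have hD : 1 ≤ Δ * r := Nat.mul_pos hΔ (by omega)
  obtain ⟨base, hloc, hbase⟩ := exists_linial_iterate (b₀ := Nat.clog 2 n) hD
    (show 4 ≤ c + 4 by omega) isOneHop_primalNeighbors isLocal_primalNeighbors
    -- The colour bound is demanded for all naturals, so numbers outside the identifier range get
    -- colour 0.
    (IsLocal.of_id 1 fun v => if v ≤ n ^ c then v else 0) (logStar n)
  -- One phase more than the potential allows, so no node can stay undecided. Passing from `c + 4`
  -- to `c + 5` doubles the exponent, which pays for the additive constants left by the first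
  -- reduction.
  obtain ⟨S, hS, hmis⟩ := exists_phases hΔ (show 4 ≤ c + 5 by omega)
    (iterate_clog_logStar_le_one r) hloc (Δ * Nat.log 2 (r ^ 3) + 1)
  refine ⟨S, fun _ _ => ⟨hS, fun E hE hid => ?_⟩⟩
  have hprop : IsProper (primalNeighbors E) fun v => if v ≤ n ^ c then v else 0 := by
    intro v u hu
    obtain ⟨hne, e, he, hv, hu⟩ := mem_primalNeighbors.1 hu
    simpa [hid e he v hv, hid e he u hu] using hne
  obtain ⟨h1, h2⟩ := hbase E hE.isGraph_primalNeighbors hprop fun v => by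
    split_ifs with hle
    · exact hle.trans_lt clog_mul_bound
    · positivity
  obtain ⟨h3, h4⟩ := hmis E hE h1 fun v => (h2 v).trans_le (by
    refine Nat.pow_le_pow_right two_pos ?_
    have e1 := iterate_clog_logStar_le_one n
    have e2 := clog_mul_le Δ r
    have e3 : 1 ≤ Nat.clog 2 r := Nat.clog_pos one_lt_two hr
    have e4 : 2 ^ (c + 5) = 2 ^ (c + 4) * 2 := pow_succ 2 (c + 4)
    rw [e4, mul_assoc]
    exact Nat.mul_le_mul_left _ (by omega))
  refine ⟨h3, fun v hv => ?_⟩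
  have := h4 v hv
  omega

/-- There are at most 4 Δ log r phases, as log r ≥ 1. This gives 128 = 4 · 32, and 13 = 4 · 3 + 1
with the initial round. -/
theorem rounds_le (c n Δ r : ℕ) (hr : 2 ≤ r) (hΔ : 1 ≤ Δ) :
    (rounds c n Δ r : ℝ) ≤ (13 + 128 * 2 ^ (c + 5)) * ((Δ : ℝ) ^ 2 * Real.logb 2 r
      + (Δ : ℝ) * Real.logb 2 r * (logStar r : ℝ) + (logStar n : ℝ)) := by
  have hr' : (2 : ℝ) ≤ r := by exact_mod_cast hr
  have hd : (1 : ℝ) ≤ Δ := by exact_mod_cast hΔ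
  have hl : 1 ≤ Real.logb 2 r := by
    rw [Real.le_logb_iff_rpow_le one_lt_two (by linarith)]
    simpa using hr'
  have hlog : (Nat.log 2 (r ^ 3) : ℝ) ≤ 3 * Real.logb 2 r := by
    have := Real.natLog_le_logb (r ^ 3) 2
    push_cast at this
    rwa [Real.logb_pow] at this
  have hs : (0 : ℝ) ≤ logStar r := Nat.cast_nonneg _
  have hn : (0 : ℝ) ≤ logStar n := Nat.cast_nonneg _
  have hm : (0 : ℝ) < 2 ^ (c + 5) := by positivity
  simp only [rounds]
  push_cast
  generalize (logStar r : ℝ) = s at *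
  generalize (logStar n : ℝ) = t at *
  generalize Real.logb 2 (r : ℝ) = l at *
  generalize (2 : ℝ) ^ (c + 5) = m at *
  generalize (Nat.log 2 (r ^ 3) : ℝ) = g at *
  generalize (Δ : ℝ) = d at *
  have hdl : 1 ≤ d * l := one_le_mul_of_one_le_of_one_le hd hl
  have h1 : d * g + 1 ≤ 4 * (d * l) := by nlinarith
  have h2 : (d * g + 1) * (3 + s + 32 * m * d) ≤ 4 * (d * l) * (3 + s + 32 * m * d) :=
    mul_le_mul_of_nonneg_right h1 (by positivity)
  have h3 : d * l ≤ d ^ 2 * l := by nlinarith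
  have h4 : 0 ≤ d * l * s := by positivity
  have h5 : 0 ≤ m * t := by positivity
  have h6 : 0 ≤ m * (d * l * s) := by positivity
  nlinarith

/-! ### From identifiers back to the hypergraph -/

section Transfer

variable {α : Type*} {H : Hypergraph α}

theorem isMIS_of_blocked {S : Set α} (hSV : S ⊆ H.vertexSet) (hS : ∀ e ∈ H.edgeSet, ¬ e ⊆ S)
    (hmax : ∀ v ∈ H.vertexSet, v ∉ S → ∃ e ∈ H.edgeSet, v ∈ e ∧ ∀ u ∈ e, u ≠ v → u ∈ S) :
    H.IsMIS S := by
  refine ⟨⟨hSV, fun e he h => hS e he (Set.inter_eq_left.1 h)⟩, fun S' hS' hle v hv => ?_⟩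
  by_contra hvS
  obtain ⟨e, he, -, hu⟩ := hmax v (hS'.1 hv) hvS
  refine hS'.2 e he (Set.inter_eq_left.2 fun u hue => ?_)
  by_cases huv : u = v
  · rwa [huv]
  · exact hle (hu u hue huv)

theorem edgeSet_finite (hfin : H.vertexSet.Finite) : H.edgeSet.Finite :=
  hfin.finite_subsets.subset fun _ he => H.subset_vertexSet_of_mem_edgeSet' he

theorem ncard_le_rank (hfin : H.vertexSet.Finite) {e : Set α} (he : e ∈ H.edgeSet) :
    e.ncard ≤ H.rank :=
  le_csSup ((edgeSet_finite hfin).image _).bddAbove ⟨e, he, rfl⟩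

theorem degree_le_maxDegree (hfin : H.vertexSet.Finite) {v : α} (hv : v ∈ H.vertexSet) :
    H.degree v ≤ H.maxDegree :=
  le_csSup (hfin.image _).bddAbove ⟨v, hv, rfl⟩

theorem degree_pos_iff (hfin : H.vertexSet.Finite) {v : α} :
    0 < H.degree v ↔ ∃ e ∈ H.edgeSet, v ∈ e :=
  Set.ncard_pos ((edgeSet_finite hfin).subset (Set.sep_subset _ _))

theorem one_le_maxDegree (hfin : H.vertexSet.Finite) (hne : ∀ e ∈ H.edgeSet, e.Nonempty)
    (hr : 2 ≤ H.rank) : 1 ≤ H.maxDegree := by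
  have : H.edgeSet.Nonempty := by
    by_contra h
    rw [Set.not_nonempty_iff_eq_empty] at h
    simp [Hypergraph.rank, h] at hr
  obtain ⟨e, he⟩ := this
  obtain ⟨v, hv⟩ := hne e he
  exact le_trans ((degree_pos_iff hfin).2 ⟨e, he, hv⟩)
    (degree_le_maxDegree hfin (H.subset_vertexSet_of_mem_edgeSet' he hv))

theorem exists_finset_edges (hfin : H.vertexSet.Finite) (ident : α → ℕ) :
    ∃ E : Finset (Finset ℕ), ∀ f : Finset ℕ,
      f ∈ E ↔ ∃ e ∈ H.edgeSet, (f : Set ℕ) = ident '' e := by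
  have h : {f : Finset ℕ | ∃ e ∈ H.edgeSet, (f : Set ℕ) = ident '' e}.Finite := by
    refine (((edgeSet_finite hfin).image fun e => ident '' e).preimage
      (Finset.coe_injective (α := ℕ)).injOn).subset ?_
    rintro f ⟨e, he, hf⟩
    exact ⟨e, he, hf.symm⟩
  exact ⟨h.toFinset, fun f => h.mem_toFinset⟩

variable {ident : α → ℕ} {E : Finset (Finset ℕ)}

theorem isBounded_of_image (hfin : H.vertexSet.Finite) (hne : ∀ e ∈ H.edgeSet, e.Nonempty)
    (hinj : Set.InjOn ident H.vertexSet)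
    (hE : ∀ f : Finset ℕ, f ∈ E ↔ ∃ e ∈ H.edgeSet, (f : Set ℕ) = ident '' e) :
    IsBounded H.maxDegree H.rank E where
  nonempty f hf := by
    obtain ⟨e, he, hfe⟩ := (hE f).1 hf
    rw [← Finset.coe_nonempty, hfe]
    exact (hne e he).image ident
  degree_le x := by
    rcases Finset.eq_empty_or_nonempty {f ∈ E | x ∈ f} with h | ⟨f, hf⟩
    · simp [h]
    obtain ⟨hf, hx⟩ := Finset.mem_filter.1 hf
    obtain ⟨e, he, hfe⟩ := (hE f).1 hf
    rw [← Finset.mem_coe, hfe] at hx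
    obtain ⟨v, hv, rfl⟩ := hx
    have hvV := H.subset_vertexSet_of_mem_edgeSet' he hv
    refine le_trans ?_ (degree_le_maxDegree hfin hvV)
    have hfe : {e ∈ H.edgeSet | v ∈ e}.Finite :=
      (edgeSet_finite hfin).subset (Set.sep_subset _ _)
    have hsub : (fun f : Finset ℕ => (f : Set ℕ)) '' ({f ∈ E | ident v ∈ f} : Finset (Finset ℕ)) ⊆
        (fun e => ident '' e) '' {e ∈ H.edgeSet | v ∈ e} := by
      rintro _ ⟨f, hf, rfl⟩
      obtain ⟨hf, hx⟩ := Finset.mem_filter.1 hf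
      obtain ⟨e', he', hfe'⟩ := (hE f).1 hf
      refine ⟨e', ⟨he', ?_⟩, hfe'.symm⟩
      rw [← Finset.mem_coe, hfe'] at hx
      exact (hinj.mem_image_iff (H.subset_vertexSet_of_mem_edgeSet' he') hvV).1 hx
    have h1 := Set.ncard_le_ncard hsub (hfe.image _)
    rw [Set.ncard_image_of_injective _ Finset.coe_injective, Set.ncard_coe_finset] at h1
    exact h1.trans (Set.ncard_image_le hfe)
  card_le f hf := by
    obtain ⟨e, he, hfe⟩ := (hE f).1 hf
    rw [← Set.ncard_coe_finset, hfe]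
    exact (Set.ncard_image_le (hfin.subset (H.subset_vertexSet_of_mem_edgeSet' he))).trans
      (ncard_le_rank hfin he)

theorem isMIS_of_image (hfin : H.vertexSet.Finite) (hinj : Set.InjOn ident H.vertexSet)
    (hE : ∀ f : Finset ℕ, f ∈ E ↔ ∃ e ∈ H.edgeSet, (f : Set ℕ) = ident '' e)
    {S : ℕ → Prop} (hS : Independent E S) (hdec : ∀ v, ¬ Undecided E S v) :
    H.IsMIS {v | v ∈ H.vertexSet ∧ S (ident v)} := by
  refine isMIS_of_blocked (fun v hv => hv.1) (fun e he hsub => ?_) fun v hv hvS => ?_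
  · have hef : (ident '' e).Finite :=
      (hfin.subset (H.subset_vertexSet_of_mem_edgeSet' he)).image ident
    obtain ⟨x, hx, hSx⟩ := hS hef.toFinset ((hE _).2 ⟨e, he, hef.coe_toFinset⟩)
    obtain ⟨u, hu, rfl⟩ := hef.mem_toFinset.1 hx
    exact hSx (hsub hu).2
  · have hSv : ¬ S (ident v) := fun h => hvS ⟨hv, h⟩
    have hb : Blocked E S (ident v) := by
      by_contra hb
      exact hdec _ ⟨hSv, hb⟩
    obtain ⟨-, f, hf, hvf, hu⟩ := hb
    obtain ⟨e, he, hfe⟩ := (hE f).1 hf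
    have heV : e ⊆ H.vertexSet := H.subset_vertexSet_of_mem_edgeSet' he
    rw [← Finset.mem_coe, hfe] at hvf
    refine ⟨e, he, (hinj.mem_image_iff heV hv).1 hvf, fun u hue huv => ⟨heV hue, ?_⟩⟩
    refine hu (ident u) ?_ fun h => huv (hinj (heV hue) hv h)
    rw [← Finset.mem_coe, hfe]
    exact ⟨u, hue, rfl⟩

/-- All hyperedges are singletons, so precisely the isolated nodes can join. -/
theorem isMIS_of_rank_le_one (hfin : H.vertexSet.Finite) (hne : ∀ e ∈ H.edgeSet, e.Nonempty)
    (hr : H.rank ≤ 1) : H.IsMIS {v | v ∈ H.vertexSet ∧ H.degree v = 0} := by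
  refine isMIS_of_blocked (fun v hv => hv.1) (fun e he hsub => ?_) fun v hv hvS => ?_
  · obtain ⟨v, hv⟩ := hne e he
    have := (degree_pos_iff hfin).2 ⟨e, he, hv⟩
    exact this.ne' (hsub hv).2
  · obtain ⟨e, he, hve⟩ := (degree_pos_iff hfin).1
      (Nat.pos_of_ne_zero fun h => hvS ⟨hv, h⟩)
    refine ⟨e, he, hve, fun u hu huv => (huv ?_).elim⟩
    exact (Set.ncard_le_one (hfin.subset (H.subset_vertexSet_of_mem_edgeSet' he))).1
      ((ncard_le_rank hfin he).trans hr) u hu v hve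

end Transfer

end HypergraphMIS

/-! ### The main theorem -/

open HypergraphMIS in
/-- For every constant `c ≥ 1` there are a deterministic LOCAL algorithm and a constant `C` such
that, on every `n`-node hypergraph with maximum degree `Δ` and rank `r` and for all unique
identifiers from `{1, …, n ^ c}`, the algorithm computes an MIS within
`C * (Δ² log r + Δ log r log* r + log* n)` communication rounds. -/
theorem theorem2 (c : ℕ) (hc : 1 ≤ c) :
    ∃ (A : LocalAlgorithm Bool) (C : ℝ),
      ∀ (α : Type*) (H : Hypergraph α) (ident : α → ℕ) (n Δ r : ℕ),
        H.vertexSet.Finite → (∀ e ∈ H.edgeSet, e.Nonempty) →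
        H.vertexSet.ncard = n → H.maxDegree = Δ → H.rank = r →
        H.IsIdentifier c ident →
        ∃ T : ℕ,
          (T : ℝ) ≤ C * ((Δ : ℝ) ^ 2 * Real.logb 2 r
              + (Δ : ℝ) * Real.logb 2 r * (logStar r : ℝ) + (logStar n : ℝ)) ∧
          A.SolvesMISWithin H ident T := by
  classical
  choose S hS using exists_local_mis c
  -- For rank at most 1 no communication is used, as the claimed bound can be 0 there, for instance
  -- for a single node.
  refine ⟨gossip (fun n Δ r => if r ≤ 1 then 0 else rounds c n Δ r)
    (fun n Δ r deg id K => if r ≤ 1 then decide (deg = 0) else decide (S n Δ r K id)),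
    13 + 128 * 2 ^ (c + 5), ?_⟩
  intro α H ident n Δ r hfin hne hn hΔ hr hid
  obtain ⟨E, hE⟩ := exists_finset_edges hfin ident
  have hcomp := gossip_computesWithin (T := fun n Δ r => if r ≤ 1 then 0 else rounds c n Δ r)
    (F := fun n Δ r deg id K => if r ≤ 1 then decide (deg = 0) else decide (S n Δ r K id))
    hfin hid.1 hE hn hΔ hr
  refine ⟨_, ?_, _, hcomp, ?_⟩
  · rcases Nat.lt_or_ge 1 r with h | h
    · simp only [if_neg (not_le.2 h)]
      subst hΔ hr
      exact rounds_le c n _ _ h (one_le_maxDegree hfin hne h)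
    · have hl : 0 ≤ Real.logb 2 r := by
        interval_cases r <;> simp
      simp only [if_pos h]
      push_cast
      positivity
  · rcases Nat.lt_or_ge 1 r with h | h
    · subst hΔ hr
      obtain ⟨hloc, hmis⟩ := hS n H.maxDegree H.rank h (one_le_maxDegree hfin hne h)
      obtain ⟨h1, h2⟩ := hmis E (isBounded_of_image hfin hne hid.1 hE) (by
        intro f hf x hx
        obtain ⟨e, he, hfe⟩ := (hE f).1 hf
        rw [← Finset.mem_coe, hfe] at hx
        obtain ⟨v, hv, rfl⟩ := hx
        exact hn ▸ (hid.2 v (H.subset_vertexSet_of_mem_edgeSet' he hv)).2)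
      have := isMIS_of_image hfin hid.1 hE h1 h2
      simpa only [if_neg (not_le.2 h), hloc.known_eq, decide_eq_true_eq] using this
    · have := isMIS_of_rank_le_one hfin hne (hr.trans_le h)
      simpa only [if_pos h, decide_eq_true_eq] using this
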